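/- Let $A$ be a set, $\Omega_A=\{-1,1\}^A$ with the product topology and the uniform (product) probability measure $\mathbb P_A$, let $r_\alpha(\omega)=\omega(\alpha)$, and for finite $S\subset A$ let $w_S=\prod_{\alpha\in S}r_\alpha$ (a Walsh character of order $|S|$) and $\hat f(w_S)=\int f\,w_S\,d\mathbb P_A$. For $F\subset A$ and real $\mathbf x\in l^2_{\mathbb R}(F)$ let $\mathfrak R_F(i\mathbf x)=\prod_{\alpha\in F}(1+i\mathbf x(\alpha)r_\alpha)$ be the element of $L^\infty(\Omega_A,\mathbb P_A)$ whose Walsh transform is $w_S\mapsto\prod_{\alpha\in S}i\mathbf x(\alpha)$ for $S\subset F$ and $0$ otherwise, and let $Q_F(\mathbf x)=\operatorname{Im}\mathfrak R_F(i\mathbf x)$. An element of $L^\infty$ is said to be in $C(\Omega_A)$ if it agrees $\mathbb P_A$-a.e. with a continuous function. All unit balls are closed. (a) For $\mathbf x$ in the unit ball of $l^2_{\mathbb R}(A)$: $Q_A(\mathbf x)\in C(\Omega_A)$ if and only if $\mathbf x\in l^1_{\mathbb R}(A)$. Now let $A$ be infinite, let $\{A_j\}_{j\ge1}$ be any partition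 of $A$ into sets of the same cardinality as $A$, let $C_j$ be the set of Walsh characters $w_S$ with $S\subset A_j$ and $|S|$ odd, $|S|\ge3$, and let $\tau_0:A\to A_1$ and $\tau_j:C_j\to A_{j+1}$ $(j\ge1)$ be any bijections. Put $\delta=\sqrt{\sinh 1-1}$. For real $\mathbf x$ in the unit ball of $l^2_{\mathbb R}(A)$ define $\mathbf x^{(1)}(\tau_0\alpha)=\mathbf x(\alpha)$ for $\alpha\in A$, and for $j\ge2$ $$\mathbf x^{(j)}(\tau_{j-1}w)=\delta^{j-2}\,\Big(Q_{A_{j-1}}\big(\mathbf x^{(j-1)}/\delta^{j-2}\big)\Big)^{\wedge}(w),\qquad w\in C_{j-1},$$ and $$\Phi(\mathbf x)=\sum_{j=1}^\infty (i\delta)^{j-1}Q_{A_j}\big(\mathbf x^{(j)}/\delta^{j-1}\big)\in L^\infty(\Omega_A,\mathbb P_A);$$ for complex $\mathbf x=\mathbf u+i\mathbf v$ in the unit ball $B_{l^2(A)}$ of $l^2(A)$, with $\mathbf u,\mathbf v$ real, let $\Phi(\mathbf x)=\Phi(\mathbf u)+i\Phi(\mathbf v)$. Then: (b) for $\mathbf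 x\in B_{l^2(A)}$: $\Phi(\mathbf x)\in C(\Omega_A)$ if and only if $\mathbf x\in l^1(A)$; (c) $\Phi$ is not continuous from $B_{l^2(A)}$ with the $l^2$-norm to $L^\infty(\Omega_A,\mathbb P_A)$ with the $L^\infty$-norm. -/

import Mathlib

open MeasureTheory Set
open scoped ENNReal

noncomputable section

namespace Dyadic

/-- The dyadic group `{-1,1}^A`, with the product topology and the σ-field generated by
the cylinder sets. -/
abbrev Omega (A : Type*) : Type _ := A → ℤˣ

/-- The uniform probability measure on `{-1,1}^A`: the product of the uniform measures
on the two-point factors. -/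
def prob (A : Type*) : Measure (Omega A) :=
  Measure.infinitePi fun _ : A => (PMF.uniformOfFintype ℤˣ).toMeasure

instance (A : Type*) : IsProbabilityMeasure (prob A) := by
  unfold prob; infer_instance

/-- `L^∞({-1,1}^A)`, complex valued, with the essential supremum norm. -/
abbrev Linf (A : Type*) : Type _ := Lp ℂ ∞ (prob A)

variable {A : Type*}

/-- The Walsh character `∏_{α ∈ S} r_α`, where `r_α(ω) = ω(α)`. The order of the character is
the cardinality of `S`, and `S ↦ walsh S` enumerates all Walsh characters without repetition. -/
def walsh (S : Finset A) (ω : Omega A) : ℂ := ∏ α ∈ S, (((ω α : ℤˣ) : ℤ) : ℂ)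

/-- The Walsh transform of `f`, at the character indexed by `S`. -/
def walshCoeff (f : Linf A) (S : Finset A) : ℂ := ∫ ω, walsh S ω * f ω ∂(prob A)

open Classical in
/-- The (unique) element of `L^∞` represented by the Walsh series `∑ c(S) walsh S`
(and `0` if the series does not represent an element of `L^∞`). -/
def ofWalshSeries (c : Finset A → ℂ) : Linf A :=
  if h : ∃ f : Linf A, ∀ S, walshCoeff f S = c S then h.choose else 0

open Classical in
/-- Walsh coefficients of the formal Riesz product `∏_{α ∈ F} (1 + z(α) r_α)`. Only the values
of `z` on `F` matter. -/
def rieszSeries (F : Set A) (z : A → ℂ) (S : Finset A) : ℂ :=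
  if (S : Set A) ⊆ F then ∏ α ∈ S, z α else 0

/-- The Riesz product `∏_{α ∈ F} (1 + i x(α) r_α)`, for real `x`, square summable on `F`. -/
def riesz (F : Set A) (x : A → ℝ) : Linf A :=
  ofWalshSeries (rieszSeries F fun α => Complex.I * x α)

/-- `Q_F(x)`, the imaginary part of the Riesz product `∏_{α ∈ F} (1 + i x(α) r_α)`. -/
def Q (F : Set A) (x : A → ℝ) : Linf A :=
  (Complex.ofRealCLM.comp Complex.imCLM).compLp (riesz F x)

/-- Walsh characters of odd order at least `3` on the coordinates in `F`. -/
def oddChars (F : Set A) : Set (Finset A) :=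
  {S | (S : Set A) ⊆ F ∧ ∃ k : ℕ, 1 ≤ k ∧ S.card = 2 * k + 1}

/-- The choices on which the construction of `Φ` depends: a partition of `A` into blocks
`A_1, A_2, …` (here `block 0, block 1, …`) of the same cardinality as `A`, a bijection from `A`
to the first block, and for each `j` a bijection from the characters of odd order at least `3`
on a block to the next block. -/
structure Scheme (A : Type*) where
  block : ℕ → Set A
  disjoint_block : Pairwise fun j k => Disjoint (block j) (block k)
  iUnion_block : ⋃ j, block j = univ
  card_block : ∀ j, Cardinal.mk (block j) = Cardinal.mk A
  base : A ≃ block 0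
  step : ∀ j, oddChars (block j) ≃ block (j + 1)

/-- The constant `δ = √(sinh 1 - 1)`. -/
def delta : ℝ := √(Real.sinh 1 - 1)

open Classical in
/-- The vectors `x^{(j+1)}` on the blocks `block j`, extended by `0` to all of `A`.
(The Walsh coefficients of `Q` are real.) -/
def level (D : Scheme A) (x : A → ℝ) : ℕ → A → ℝ
  | 0 => fun β => if h : β ∈ D.block 0 then x (D.base.symm ⟨β, h⟩) else 0
  | j + 1 => fun β =>
      if h : β ∈ D.block (j + 1) then
        delta ^ j * (walshCoeff (Q (D.block j) fun α => level D x j α / delta ^ j)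
          ((D.step j).symm ⟨β, h⟩ : Finset A)).re
      else 0

/-- `Φ` on real vectors: the `L^∞`-norm convergent series
`∑_j (iδ)^j Q_{block j}(x^{(j+1)} / δ^j)`. -/
def PhiReal (D : Scheme A) (x : A → ℝ) : Linf A :=
  ∑' j : ℕ, (Complex.I * (delta : ℂ)) ^ j • Q (D.block j) fun α => level D x j α / delta ^ j

/-- The map `Φ` from the closed unit ball of complex `l²(A)` to `L^∞`:
`Φ(u + iv) = Φ(u) + iΦ(v)` for real `u`, `v`. -/
def Phi (D : Scheme A) (x : Metric.closedBall (0 : lp (fun _ : A => ℂ) 2) 1) : Linf A :=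
  PhiReal D (fun α => (x.1 α).re) + Complex.I • PhiReal D (fun α => (x.1 α).im)

/-- The element `f` of `L^∞` is (the class of) a continuous function on `{-1,1}^A`. -/
def IsContinuousClass (f : Linf A) : Prop := ∃ g : C(Omega A, ℂ), f =ᵐ[prob A] g

end Dyadic

end

open Dyadic (Omega prob Linf walsh walshCoeff ofWalshSeries rieszSeries riesz Q oddChars Scheme
  delta level PhiReal Phi IsContinuousClass)

namespace WalshSeries

variable {A : Type*}

/-! By Stone–Weierstrass and the full support of the measure, the classes of continuous functions
are exactly the `L^∞`-closure of the Walsh polynomials (`isContinuousClass_iff`), hence a closed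
subspace.

If `x` is in `l¹`, the Walsh series of `Q` converges absolutely, since its coefficients are
dominated by `∏ α ∈ S, |x α|`. Summability passes from each level to the next, so every term of `Φ`
is continuous, and so is the norm-convergent sum.

For the converse (`summable_abs_of_isContinuousClass`), suppose `x` is not in `l¹`. Approximate the
function by a Walsh polynomial with spectrum over a finite `T` and choose a finite `F` disjoint from
`T` with `∑ |x|` at least 1 on `F`. Integrate against the probability density `∏ (1 + t r_α)` over
`F`, with `t` a small multiple of the sign of `x`. The polynomial contributes only its constant
coefficient, while the function contributes `Im ∏ (1 + i y_α)` with `y ≥ 0` and `∑ y = 1`, which is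
bounded below. Over the first block `Φ` of a real vector has the coefficients of `Q`, because the
later blocks are disjoint from it; the later levels play no other role in this direction.

The constant `δ` enters through `sinh 1 - 1`, which bounds the squared `l²` norm of the coefficients
of odd order at least 3; dividing by `δ` keeps each level in the unit ball, and `δ < 1` makes the
series for `Φ` converge (`inUnitBall_scaledLevel`, `hasSum_PhiReal`).

Discontinuity follows from the equivalence: finite truncations of a vector in `l²` but not in `l¹`
have continuous images, and continuity of `Φ` would carry this to the limit. -/

instance : DiscreteMeasurableSpace ℤˣ :=
  ⟨fun s => ⟨Units.val '' s, MeasurableSet.of_discrete,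
    Set.preimage_image_eq s Units.val_injective⟩⟩

/-! ### Walsh characters -/

lemma measurable_walsh (S : Finset A) : Measurable (walsh S) := by
  unfold walsh
  refine Finset.measurable_prod S fun α _ => ?_
  exact (Measurable.of_discrete (f := fun u : ℤˣ => ((u : ℤ) : ℂ))).comp (measurable_pi_apply α)

lemma continuous_walsh (S : Finset A) : Continuous (walsh S) := by
  unfold walsh
  refine continuous_finsetProd S fun α _ => ?_
  exact (continuous_of_discreteTopology (f := fun u : ℤˣ => ((u : ℤ) : ℂ))).comp
    (continuous_apply α)

lemma norm_walsh (S : Finset A) (ω : Omega A) : ‖walsh S ω‖ = 1 := by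
  unfold walsh
  rw [norm_prod]
  refine Finset.prod_eq_one fun α _ => ?_
  rcases Int.units_eq_one_or (ω α) with h | h <;> simp [h]

lemma conj_walsh (S : Finset A) (ω : Omega A) : (starRingEnd ℂ) (walsh S ω) = walsh S ω := by
  simp [walsh]

lemma walsh_empty (ω : Omega A) : walsh ∅ ω = 1 := by simp [walsh]

open Classical in
lemma walsh_mul_walsh (S T : Finset A) (ω : Omega A) :
    walsh S ω * walsh T ω = walsh (symmDiff S T) ω := by
  have sq : ∀ α, (((ω α : ℤˣ) : ℤ) : ℂ) * (((ω α : ℤˣ) : ℤ) : ℂ) = 1 := fun α => by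
    rcases Int.units_eq_one_or (ω α) with h | h <;> simp [h]
  have hS : walsh S ω = walsh (S \ T) ω * walsh (S ∩ T) ω := by
    unfold walsh
    rw [← Finset.prod_union (Finset.disjoint_sdiff_inter S T), Finset.sdiff_union_inter]
  have hT : walsh T ω = walsh (T \ S) ω * walsh (S ∩ T) ω := by
    unfold walsh
    rw [Finset.inter_comm, ← Finset.prod_union (Finset.disjoint_sdiff_inter T S),
      Finset.sdiff_union_inter]
  have hU : walsh (symmDiff S T) ω = walsh (S \ T) ω * walsh (T \ S) ω := by
    unfold walsh
    rw [symmDiff, Finset.sup_eq_union, Finset.prod_union disjoint_sdiff_sdiff]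
  have hI : walsh (S ∩ T) ω * walsh (S ∩ T) ω = 1 := by
    unfold walsh
    rw [← Finset.prod_mul_distrib]
    exact Finset.prod_eq_one fun α _ => sq α
  rw [hS, hT, hU]
  linear_combination (walsh (S \ T) ω * walsh (T \ S) ω) * hI

lemma integral_uniform_sign :
    ∫ u : ℤˣ, ((u : ℤ) : ℂ) ∂(PMF.uniformOfFintype ℤˣ).toMeasure = 0 := by
  rw [PMF.integral_eq_sum]
  have : (Finset.univ : Finset ℤˣ) = {1, -1} := by decide
  simp [this]

lemma integral_walsh_of_nonempty {S : Finset A} (hS : S.Nonempty) :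
    ∫ ω, walsh S ω ∂prob A = 0 := by
  let g : (S → ℤˣ) → ℂ := fun y => ∏ i, (((y i : ℤˣ) : ℤ) : ℂ)
  have h1 : ∀ ω : Omega A, walsh S ω = g (S.restrict ω) := fun ω =>
    (Finset.prod_coe_sort S fun α => (((ω α : ℤˣ) : ℤ) : ℂ)).symm
  have hg : Measurable g := by
    refine Finset.measurable_prod _ fun α _ => ?_
    exact (Measurable.of_discrete (f := fun u : ℤˣ => ((u : ℤ) : ℂ))).comp (measurable_pi_apply α)
  rw [integral_congr_ae (ae_of_all _ h1)]
  refine (integral_restrict_infinitePi (fun _ : A => (PMF.uniformOfFintype ℤˣ).toMeasure)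
    hg.aestronglyMeasurable).trans ?_
  refine (integral_fintype_prod_eq_prod (fun (_ : S) (u : ℤˣ) => ((u : ℤ) : ℂ))).trans ?_
  obtain ⟨α, hα⟩ := hS
  exact Finset.prod_eq_zero (Finset.mem_univ ⟨α, hα⟩) integral_uniform_sign

lemma integral_walsh_mul_walsh [DecidableEq (Finset A)] (S T : Finset A) :
    ∫ ω, walsh S ω * walsh T ω ∂prob A = if S = T then 1 else 0 := by
  classical
  simp_rw [walsh_mul_walsh]
  split_ifs with h
  · subst h
    simp [walsh_empty]
  · refine integral_walsh_of_nonempty (Finset.nonempty_iff_ne_empty.2 fun h0 => h ?_)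
    rwa [← Finset.bot_eq_empty, symmDiff_eq_bot] at h0

/-! ### The Walsh transform as a bounded functional on `L^∞` -/

lemma integrable_linf (f : Linf A) : Integrable f (prob A) := (Lp.memLp f).integrable le_top

lemma ae_norm_le (f : Linf A) : ∀ᵐ ω ∂prob A, ‖f ω‖ ≤ ‖f‖ := by
  have h := ae_le_eLpNormEssSup (f := (f : Omega A → ℂ)) (μ := prob A)
  filter_upwards [h] with ω hω
  rw [← eLpNorm_exponent_top] at hω
  have := ENNReal.toReal_mono (Lp.eLpNorm_ne_top f) hω
  simpa [Lp.norm_def] using this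

lemma linf_norm_le {f : Linf A} {c : ℝ} (hc : 0 ≤ c) (h : ∀ᵐ ω ∂prob A, ‖f ω‖ ≤ c) :
    ‖f‖ ≤ c := by
  simpa using Lp.norm_le_of_ae_bound hc h

lemma integrable_walsh_mul (f : Linf A) (S : Finset A) :
    Integrable (fun ω => walsh S ω * f ω) (prob A) :=
  (integrable_linf f).bdd_mul (measurable_walsh S).aestronglyMeasurable
    (ae_of_all _ fun ω => (norm_walsh S ω).le)

/-- A Walsh character as an element of `L^∞`. -/
noncomputable def walshLinf (S : Finset A) : Linf A :=
  (memLp_top_of_bound (measurable_walsh S).aestronglyMeasurable 1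
    (ae_of_all _ fun ω => (norm_walsh S ω).le)).toLp (walsh S)

lemma coeFn_walshLinf (S : Finset A) : walshLinf S =ᵐ[prob A] walsh S := MemLp.coeFn_toLp _

lemma norm_walshLinf_le (S : Finset A) : ‖walshLinf S‖ ≤ 1 := by
  refine linf_norm_le zero_le_one ?_
  filter_upwards [coeFn_walshLinf S] with ω h
  rw [h, norm_walsh]

/-- The Walsh transform at a character, as a continuous linear functional on `L^∞`. -/
noncomputable def walshCoeffCLM (S : Finset A) : Linf A →L[ℂ] ℂ :=
  LinearMap.mkContinuous
    { toFun := fun f => walshCoeff f S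
      map_add' := fun f g => by
        unfold walshCoeff
        rw [← integral_add (integrable_walsh_mul f S) (integrable_walsh_mul g S)]
        refine integral_congr_ae ?_
        filter_upwards [Lp.coeFn_add f g] with ω h
        rw [h, Pi.add_apply, mul_add]
      map_smul' := fun c f => by
        unfold walshCoeff
        rw [RingHom.id_apply, smul_eq_mul, ← integral_const_mul]
        refine integral_congr_ae ?_
        filter_upwards [Lp.coeFn_smul c f] with ω h
        rw [h, Pi.smul_apply, smul_eq_mul]
        ring } 1 fun f => by
    change ‖∫ ω, walsh S ω * f ω ∂prob A‖ ≤ 1 * ‖f‖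
    have := norm_integral_le_of_norm_le_const (μ := prob A) (f := fun ω => walsh S ω * f ω)
      (C := ‖f‖) (by
        filter_upwards [ae_norm_le f] with ω h
        rwa [norm_mul, norm_walsh, one_mul])
    simpa using this

lemma walshCoeffCLM_apply (S : Finset A) (f : Linf A) : walshCoeffCLM S f = walshCoeff f S := rfl

lemma walshCoeff_walshLinf [DecidableEq (Finset A)] (S T : Finset A) :
    walshCoeff (walshLinf T) S = if S = T then 1 else 0 := by
  rw [← integral_walsh_mul_walsh, walshCoeff]
  refine integral_congr_ae ?_
  filter_upwards [coeFn_walshLinf T] with ω h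
  rw [h]

/-! ### Uniqueness of Walsh coefficients -/

open Classical in
-- Every function on a two-point factor is affine in the sign; expanding the product of these affine
-- functions gives a Walsh polynomial.
lemma indicator_pi_eq_sum_walsh (s : Finset A) (t : A → Set ℤˣ) :
    ∃ c : Finset A → ℂ, ∀ ω : Omega A,
      ((s : Set A).pi t).indicator (fun _ => (1 : ℂ)) ω = ∑ T ∈ s.powerset, c T * walsh T ω := by
  let χ : A → ℤˣ → ℂ := fun α => (t α).indicator fun _ => 1
  let a : A → ℂ := fun α => (χ α 1 + χ α (-1)) / 2
  let b : A → ℂ := fun α => (χ α 1 - χ α (-1)) / 2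
  refine ⟨fun T => (∏ α ∈ T, b α) * ∏ α ∈ s \ T, a α, fun ω => ?_⟩
  have h1 : ((s : Set A).pi t).indicator (fun _ => (1 : ℂ)) ω = ∏ α ∈ s, χ α (ω α) := by
    by_cases h : ω ∈ (s : Set A).pi t
    · rw [Set.indicator_of_mem h]
      exact (Finset.prod_eq_one fun α hα => Set.indicator_of_mem (h α hα) _).symm
    · rw [Set.indicator_of_notMem h]
      simp only [Set.mem_pi, not_forall] at h
      obtain ⟨α, hα, hn⟩ := h
      exact (Finset.prod_eq_zero hα (Set.indicator_of_notMem hn _)).symm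
  have h2 : ∀ α, χ α (ω α) = b α * (((ω α : ℤˣ) : ℤ) : ℂ) + a α := fun α => by
    rcases Int.units_eq_one_or (ω α) with h | h <;> simp only [h, a, b] <;> push_cast <;> ring
  rw [h1, Finset.prod_congr rfl fun α _ => h2 α, Finset.prod_add]
  refine Finset.sum_congr rfl fun T _ => ?_
  rw [walsh, Finset.prod_mul_distrib]
  ring

/-- Cylinder indicators are Walsh polynomials, so `f` integrates to zero over cylinders, and the π-λ
theorem extends this to all measurable sets. -/
lemma eq_zero_of_walshCoeff {f : Linf A} (hf : ∀ S, walshCoeff f S = 0) : f = 0 := by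
  classical
  have hcyl : ∀ (s : Finset A) (t : A → Set ℤˣ),
      ∫ ω in (s : Set A).pi t, f ω ∂prob A = 0 := fun s t => by
    obtain ⟨c, hc⟩ := indicator_pi_eq_sum_walsh s t
    rw [← integral_indicator (MeasurableSet.pi s.countable_toSet fun _ _ => .of_discrete)]
    have : ∀ ω, ((s : Set A).pi t).indicator (f : Omega A → ℂ) ω =
        ∑ T ∈ s.powerset, c T * (walsh T ω * f ω) := fun ω => by
      simp_rw [← mul_assoc]
      rw [← Finset.sum_mul, ← hc]
      by_cases h : ω ∈ (s : Set A).pi t <;> simp [h]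
    simp_rw [this]
    rw [integral_finsetSum _ fun T _ => (integrable_walsh_mul f T).const_mul _]
    refine Finset.sum_eq_zero fun T _ => ?_
    rw [integral_const_mul]
    exact mul_eq_zero_of_right _ (hf T)
  have huniv : ∫ ω, f ω ∂prob A = 0 := by
    simpa using hcyl ∅ fun _ => Set.univ
  have hall : ∀ s, MeasurableSet s → ∫ ω in s, f ω ∂prob A = 0 := by
    intro s hs
    induction s, hs using MeasurableSpace.induction_on_inter
      (generateFrom_squareCylinders (α := fun _ : A => ℤˣ)).symm
      (isPiSystem_squareCylinders (fun _ => MeasurableSpace.isPiSystem_measurableSet)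
        fun _ => MeasurableSet.univ (α := ℤˣ)) with
    | empty => simp
    | basic t ht =>
      obtain ⟨S, U, -, rfl⟩ := ht
      exact hcyl S U
    | compl t ht ih =>
      have := integral_add_compl ht (integrable_linf f)
      rwa [ih, huniv, zero_add] at this
    | iUnion g hd hm ih =>
      rw [integral_iUnion hm hd (integrable_linf f).integrableOn]
      simp [ih]
  have := ae_eq_zero_of_forall_setIntegral_eq_of_sigmaFinite (μ := prob A) (f := f)
    (fun s _ _ => (integrable_linf f).integrableOn) fun s hs _ => hall s hs
  exact (Lp.eq_zero_iff_ae_eq_zero).2 this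

lemma ext_walshCoeff {f g : Linf A} (h : ∀ S, walshCoeff f S = walshCoeff g S) : f = g := by
  refine sub_eq_zero.1 (eq_zero_of_walshCoeff fun S => ?_)
  rw [← walshCoeffCLM_apply, map_sub, walshCoeffCLM_apply, walshCoeffCLM_apply, h, sub_self]

/-! ### Continuous functions as uniform limits of Walsh polynomials -/

lemma prob_pi_singleton_pos (s : Finset A) (ω : Omega A) :
    0 < prob A ((s : Set A).pi fun α => {ω α}) := by
  rw [prob, Measure.infinitePi_pi _ fun _ _ => .of_discrete, pos_iff_ne_zero,
    Finset.prod_ne_zero_iff]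
  intro α _
  rw [PMF.toMeasure_apply_singleton _ _ .of_discrete]
  simp [PMF.uniformOfFintype_apply]

lemma prob_pos_of_isOpen {U : Set (Omega A)} (hU : IsOpen U) {ω : Omega A} (hω : ω ∈ U) :
    0 < prob A U := by
  obtain ⟨s, u, hu, hsub⟩ := isOpen_pi_iff.1 hU ω hω
  refine (prob_pi_singleton_pos s ω).trans_le (measure_mono (subset_trans ?_ hsub))
  exact Set.pi_mono fun α hα => Set.singleton_subset_iff.2 (hu α hα).2

/-- The measure charges every nonempty open set. This turns Cauchy sequences of classes into
uniformly Cauchy sequences of continuous representatives. -/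
lemma continuousMap_norm_le_of_ae_eq {f : Linf A} {g : C(Omega A, ℂ)} (h : f =ᵐ[prob A] g) :
    ‖g‖ ≤ ‖f‖ := by
  rw [ContinuousMap.norm_le _ (norm_nonneg _)]
  intro ω
  by_contra! hlt
  have hpos := prob_pos_of_isOpen (U := {ω | ‖f‖ < ‖g ω‖})
    (isOpen_lt continuous_const g.continuous.norm) hlt
  refine hpos.ne' (measure_mono_null (fun η hη => ?_) (ae_iff.1 ((ae_norm_le f).and h)))
  rintro ⟨h1, h2⟩
  rw [h2] at h1
  exact absurd hη (not_lt.2 h1)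

/-- A Walsh character as a continuous function. -/
def walshC (S : Finset A) : C(Omega A, ℂ) := ⟨walsh S, continuous_walsh S⟩

lemma walshC_apply (S : Finset A) (ω : Omega A) : walshC S ω = walsh S ω := rfl

/-- The Walsh polynomials, as a star subalgebra of the continuous functions. -/
def walshStarSubalgebra (A : Type*) : StarSubalgebra ℂ C(Omega A, ℂ) where
  carrier := (Submodule.span ℂ (range (walshC (A := A))) : Submodule ℂ C(Omega A, ℂ))
  add_mem' := Submodule.add_mem _
  mul_mem' := by
    classical
    intro f g hf hg
    have h := Submodule.mul_mem_mul (SetLike.mem_coe.1 hf) (SetLike.mem_coe.1 hg)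
    rw [Submodule.span_mul_span] at h
    refine Submodule.span_mono ?_ h
    rintro _ ⟨_, ⟨S, rfl⟩, _, ⟨T, rfl⟩, rfl⟩
    exact ⟨symmDiff S T, by ext ω; exact (walsh_mul_walsh S T ω).symm⟩
  algebraMap_mem' := fun c => by
    rw [Algebra.algebraMap_eq_smul_one]
    refine Submodule.smul_mem _ c (Submodule.subset_span (Set.mem_range.2 ⟨∅, ?_⟩))
    ext ω
    exact walsh_empty ω
  star_mem' := by
    intro f hf
    induction hf using Submodule.span_induction with
    | mem f hf =>
      obtain ⟨S, rfl⟩ := hf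
      refine Submodule.subset_span ⟨S, ?_⟩
      ext ω
      exact (conj_walsh S ω).symm
    | zero => simp
    | add f g _ _ hf hg => rw [star_add]; exact Submodule.add_mem _ hf hg
    | smul c f _ hf => rw [star_smul]; exact Submodule.smul_mem _ _ hf

lemma mem_walshStarSubalgebra {g : C(Omega A, ℂ)} :
    g ∈ walshStarSubalgebra A ↔ g ∈ Submodule.span ℂ (range (walshC (A := A))) := by
  rfl

lemma topologicalClosure_walshStarSubalgebra :
    (walshStarSubalgebra A).topologicalClosure = ⊤ := by
  refine ContinuousMap.starSubalgebra_topologicalClosure_eq_top_of_separatesPoints _ ?_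
  intro ω η hne
  obtain ⟨α, hα⟩ := Function.ne_iff.1 hne
  refine ⟨walshC {α}, ⟨walshC {α}, ?_, rfl⟩, ?_⟩
  · exact mem_walshStarSubalgebra.2 (Submodule.subset_span ⟨_, rfl⟩)
  · simpa [walshC_apply, walsh, Units.val_inj] using hα

variable (A) in
/-- The Walsh polynomials in `L^∞`. -/
noncomputable def walshSpan : Submodule ℂ (Linf A) := Submodule.span ℂ (range walshLinf)

lemma exists_walshSpan_ae_eq {g : C(Omega A, ℂ)}
    (hg : g ∈ Submodule.span ℂ (range (walshC (A := A)))) :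
    ∃ p ∈ walshSpan A, p =ᵐ[prob A] g := by
  induction hg using Submodule.span_induction with
  | mem f hf =>
    obtain ⟨S, rfl⟩ := hf
    exact ⟨walshLinf S, Submodule.subset_span ⟨S, rfl⟩, coeFn_walshLinf S⟩
  | zero => exact ⟨0, Submodule.zero_mem _, Lp.coeFn_zero _ _ _⟩
  | add f g _ _ hf hg =>
    obtain ⟨p, hp, hpf⟩ := hf
    obtain ⟨q, hq, hqg⟩ := hg
    exact ⟨p + q, Submodule.add_mem _ hp hq, (Lp.coeFn_add p q).trans (hpf.add hqg)⟩
  | smul c f _ hf =>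
    obtain ⟨p, hp, hpf⟩ := hf
    exact ⟨c • p, Submodule.smul_mem _ c hp, (Lp.coeFn_smul c p).trans (hpf.const_smul c)⟩

lemma isContinuousClass_of_mem_walshSpan {p : Linf A} (hp : p ∈ walshSpan A) :
    IsContinuousClass p := by
  unfold walshSpan at hp
  induction hp using Submodule.span_induction with
  | mem f hf =>
    obtain ⟨S, rfl⟩ := hf
    exact ⟨walshC S, coeFn_walshLinf S⟩
  | zero => exact ⟨0, Lp.coeFn_zero _ _ _⟩
  | add f g _ _ hf hg =>
    obtain ⟨p, hpf⟩ := hf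
    obtain ⟨q, hqg⟩ := hg
    exact ⟨p + q, (Lp.coeFn_add f g).trans (hpf.add hqg)⟩
  | smul c f _ hf =>
    obtain ⟨p, hpf⟩ := hf
    exact ⟨c • p, (Lp.coeFn_smul c f).trans (hpf.const_smul c)⟩

lemma mem_closure_of_isContinuousClass {f : Linf A} (hf : IsContinuousClass f) :
    f ∈ (walshSpan A).topologicalClosure := by
  obtain ⟨g, hg⟩ := hf
  refine Metric.mem_closure_iff.2 fun ε hε => ?_
  have hgt : g ∈ (walshStarSubalgebra A).topologicalClosure := by
    rw [topologicalClosure_walshStarSubalgebra]; trivial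
  obtain ⟨q, hq, hd⟩ := Metric.mem_closure_iff.1 hgt (ε / 2) (half_pos hε)
  obtain ⟨p, hp, hpq⟩ := exists_walshSpan_ae_eq (mem_walshStarSubalgebra.1 hq)
  refine ⟨p, hp, lt_of_le_of_lt ?_ (half_lt_self hε)⟩
  rw [dist_eq_norm]
  refine linf_norm_le (half_pos hε).le ?_
  filter_upwards [hg, hpq, Lp.coeFn_sub f p] with ω h1 h2 h3
  rw [h3, Pi.sub_apply, h1, h2, ← dist_eq_norm]
  exact (ContinuousMap.dist_apply_le_dist ω).trans hd.le

lemma isContinuousClass_of_mem_closure {f : Linf A}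
    (hf : f ∈ (walshSpan A).topologicalClosure) : IsContinuousClass f := by
  obtain ⟨p, hp, hpf⟩ := mem_closure_iff_seq_limit.1 hf
  choose q hq using fun n => isContinuousClass_of_mem_walshSpan (hp n)
  have hqd : ∀ m n, dist (q m) (q n) ≤ dist (p m) (p n) := fun m n => by
    rw [dist_eq_norm, dist_eq_norm]
    exact continuousMap_norm_le_of_ae_eq ((Lp.coeFn_sub (p m) (p n)).trans ((hq m).sub (hq n)))
  have hcau : CauchySeq q := by
    rw [Metric.cauchySeq_iff]
    intro ε hε
    obtain ⟨N, hN⟩ := Metric.cauchySeq_iff.1 hpf.cauchySeq ε hε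
    exact ⟨N, fun m hm n hn => (hqd m n).trans_lt (hN m hm n hn)⟩
  obtain ⟨g, hg⟩ := cauchySeq_tendsto_of_complete hcau
  refine ⟨g, ?_⟩
  have hsub : ∀ᵐ ω ∂prob A, ∀ n, ‖f ω - p n ω‖ ≤ ‖f - p n‖ := by
    refine ae_all_iff.2 fun n => ?_
    filter_upwards [ae_norm_le (f - p n), Lp.coeFn_sub f (p n)] with ω h1 h2
    rwa [h2, Pi.sub_apply] at h1
  filter_upwards [hsub, ae_all_iff.2 hq] with ω h1 h2
  have h3 : Filter.Tendsto (fun n => p n ω) Filter.atTop (nhds (f ω)) := by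
    rw [tendsto_iff_norm_sub_tendsto_zero]
    refine squeeze_zero (fun _ => norm_nonneg _) (fun n => ?_)
      (tendsto_iff_norm_sub_tendsto_zero.1 hpf)
    rw [norm_sub_rev, norm_sub_rev (p n)]
    exact h1 n
  have h4 : Filter.Tendsto (fun n => q n ω) Filter.atTop (nhds (g ω)) :=
    ((ContinuousEvalConst.continuous_eval_const ω).tendsto g).comp hg
  simp_rw [h2] at h3
  exact tendsto_nhds_unique h3 h4

lemma isContinuousClass_iff {f : Linf A} :
    IsContinuousClass f ↔ f ∈ (walshSpan A).topologicalClosure :=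
  ⟨mem_closure_of_isContinuousClass, isContinuousClass_of_mem_closure⟩

/-- An absolutely convergent Walsh series has a continuous sum. -/
lemma isContinuousClass_of_summable {f : Linf A} (hf : Summable fun S => ‖walshCoeff f S‖) :
    IsContinuousClass f := by
  classical
  have hs : Summable fun S => walshCoeff f S • walshLinf S :=
    .of_norm_bounded hf fun S => by
      rw [norm_smul]
      exact mul_le_of_le_one_right (norm_nonneg _) (norm_walshLinf_le S)
  have hfe : f = ∑' S, walshCoeff f S • walshLinf S := by
    refine ext_walshCoeff fun T => ?_
    have h := hs.hasSum.mapL (walshCoeffCLM T)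
    simp only [map_smul, walshCoeffCLM_apply, walshCoeff_walshLinf, smul_eq_mul, mul_ite, mul_one,
      mul_zero] at h
    refine HasSum.unique ?_ h
    simpa using hasSum_single (f := fun S => if T = S then walshCoeff f S else 0) T
      fun S hS => if_neg hS.symm
  rw [isContinuousClass_iff, hfe]
  refine (Submodule.isClosed_topologicalClosure _).mem_of_tendsto hs.hasSum
    (Filter.Eventually.of_forall fun s => ?_)
  exact Submodule.le_topologicalClosure _ (Submodule.sum_mem _ fun S _ =>
    Submodule.smul_mem _ _ (Submodule.subset_span ⟨S, rfl⟩))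

/-! ### Riesz products -/

/-- `x` belongs to the closed unit ball of real `l²(A)`. -/
def InUnitBall (x : A → ℝ) : Prop := ∀ T : Finset A, ∑ α ∈ T, x α ^ 2 ≤ 1

lemma InUnitBall.summable {x : A → ℝ} (hx : InUnitBall x) : Summable fun α => x α ^ 2 :=
  summable_of_sum_le (fun _ => sq_nonneg _) hx

/-- A Walsh character as an element of `L²`. -/
noncomputable def walshL2 (S : Finset A) : Lp ℂ 2 (prob A) :=
  ((memLp_top_of_bound (measurable_walsh S).aestronglyMeasurable 1
    (ae_of_all _ fun ω => (norm_walsh S ω).le)).mono_exponent le_top).toLp (walsh S)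

lemma coeFn_walshL2 (S : Finset A) : walshL2 S =ᵐ[prob A] walsh S := MemLp.coeFn_toLp _

lemma inner_walshL2 (S : Finset A) (f : Lp ℂ 2 (prob A)) :
    inner ℂ (walshL2 S) f = ∫ ω, walsh S ω * f ω ∂prob A := by
  rw [L2.inner_def]
  refine integral_congr_ae ?_
  filter_upwards [coeFn_walshL2 S] with ω h
  rw [h, RCLike.inner_apply, conj_walsh, mul_comm]

lemma orthonormal_walshL2 : Orthonormal ℂ (walshL2 (A := A)) := by
  classical
  rw [orthonormal_iff_ite]
  intro S T
  rw [inner_walshL2, ← integral_walsh_mul_walsh]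
  refine integral_congr_ae ?_
  filter_upwards [coeFn_walshL2 T] with ω h
  rw [h]

/-- An imaginary perturbation changes the modulus only to second order: each factor has squared
modulus `1 + x α ^ 2`, so the squared product is at most `e < 4`. -/
lemma norm_prod_one_add_I_mul_le {x : A → ℝ} (hx : InUnitBall x) (T : Finset A) (ω : Omega A) :
    ‖∏ α ∈ T, (1 + Complex.I * x α * (((ω α : ℤˣ) : ℤ) : ℂ))‖ ≤ 2 := by
  have h1 : ∀ α, ‖1 + Complex.I * x α * (((ω α : ℤˣ) : ℤ) : ℂ)‖ ^ 2 = 1 + x α ^ 2 := fun α => by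
    rw [Complex.sq_norm, Complex.normSq_apply]
    rcases Int.units_eq_one_or (ω α) with h | h <;> simp [h] <;> ring
  refine le_of_sq_le_sq ?_ zero_le_two
  rw [norm_prod, ← Finset.prod_pow, Finset.prod_congr rfl fun α _ => h1 α]
  calc ∏ α ∈ T, (1 + x α ^ 2) ≤ Real.exp (∑ α ∈ T, x α ^ 2) :=
        Real.prod_one_add_le_exp_sum _ fun α => sq_nonneg _
    _ ≤ Real.exp 1 := Real.exp_le_exp.2 (hx T)
    _ ≤ 2 ^ 2 := by linarith [Real.exp_one_lt_d9]

lemma prod_one_add_mul_eq_sum_walsh (z : A → ℂ) (T : Finset A) (ω : Omega A) :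
    ∏ α ∈ T, (1 + z α * (((ω α : ℤˣ) : ℤ) : ℂ)) =
      ∑ S ∈ T.powerset, (∏ α ∈ S, z α) * walsh S ω := by
  rw [Finset.prod_one_add]
  exact Finset.sum_congr rfl fun S _ => Finset.prod_mul_distrib

/-- The coefficients are square summable, so the series converges in `L²`; finite Riesz products are
uniformly bounded by 2, and an a.e. convergent subsequence of them transfers the bound to the limit.
-/
lemma exists_linf_riesz {x : A → ℝ} (hx : InUnitBall x) :
    ∃ f : Linf A, ‖f‖ ≤ 2 ∧ ∀ S, walshCoeff f S = ∏ α ∈ S, Complex.I * x α := by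
  classical
  let c : Finset A → ℂ := fun S => ∏ α ∈ S, Complex.I * x α
  have hc : Summable fun S => ‖c S‖ ^ 2 := by
    refine (summable_finsetProd_of_summable_nonneg (fun α => sq_nonneg (x α)) hx.summable).congr
      fun S => ?_
    simp [c, norm_prod, ← Finset.prod_pow]
  have hs : Summable fun S => c S • walshL2 S :=
    (orthonormal_walshL2.orthogonalFamily.summable_iff_norm_sq_summable c).2 hc
  obtain ⟨g, hg⟩ := hs
  have hcoef : ∀ S, ∫ ω, walsh S ω * g ω ∂prob A = c S := fun S => by
    rw [← inner_walshL2]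
    have h := hg.mapL (innerSL ℂ (walshL2 S))
    simp only [innerSL_apply_apply, inner_smul_right, orthonormal_iff_ite.1 orthonormal_walshL2,
      mul_ite, mul_one, mul_zero] at h
    refine h.unique ?_
    simpa using hasSum_single (f := fun T => if S = T then c T else 0) S
      fun T hT => if_neg hT.symm
  -- Only partial sums over full power sets are finite Riesz products, hence bounded; these are
  -- cofinal among all partial sums.
  have hmem : g ∈ closure (range fun T : Finset A => ∑ S ∈ T.powerset, c S • walshL2 S) :=
    mem_closure_of_tendsto (hg.comp Filter.tendsto_finset_powerset_atTop_atTop)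
      (Filter.Eventually.of_forall fun T => mem_range_self T)
  obtain ⟨p, hp, hpg⟩ := mem_closure_iff_seq_limit.1 hmem
  obtain ⟨φ, -, hφ⟩ := (tendstoInMeasure_of_tendsto_Lp hpg).exists_seq_tendsto_ae
  have hpb : ∀ᵐ ω ∂prob A, ∀ n, ‖p n ω‖ ≤ 2 := by
    refine ae_all_iff.2 fun n => ?_
    obtain ⟨T, hT⟩ := hp n
    rw [← hT]
    have h1 : ∀ᵐ ω ∂prob A, ∀ S ∈ T.powerset,
        (c S • walshL2 S : Lp ℂ 2 (prob A)) ω = c S * walsh S ω := by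
      refine (ae_ball_iff (Finset.countable_toSet _)).2 fun S _ => ?_
      filter_upwards [Lp.coeFn_smul (c S) (walshL2 S), coeFn_walshL2 S] with ω h1 h2
      rw [h1, Pi.smul_apply, h2, smul_eq_mul]
    filter_upwards [h1, Lp.coeFn_finsetSum T.powerset fun S => c S • walshL2 S] with ω h1 h2
    rw [h2, Finset.sum_apply, Finset.sum_congr rfl h1, ← prod_one_add_mul_eq_sum_walsh]
    exact norm_prod_one_add_I_mul_le hx T ω
  have hgb : ∀ᵐ ω ∂prob A, ‖g ω‖ ≤ 2 := by
    filter_upwards [hφ, hpb] with ω h1 h2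
    exact le_of_tendsto h1.norm (Filter.Eventually.of_forall fun n => h2 _)
  have hm := memLp_top_of_bound (Lp.aestronglyMeasurable g) 2 hgb
  refine ⟨hm.toLp g, linf_norm_le zero_le_two ?_, fun S => ?_⟩
  · filter_upwards [hm.coeFn_toLp, hgb] with ω h1 h2
    rwa [h1]
  · refine Eq.trans (integral_congr_ae ?_) (hcoef S)
    filter_upwards [hm.coeFn_toLp] with ω h
    rw [h]

lemma walshCoeff_ofWalshSeries {c : Finset A → ℂ} (h : ∃ f : Linf A, ∀ S, walshCoeff f S = c S)
    (S : Finset A) : walshCoeff (ofWalshSeries c) S = c S := by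
  rw [ofWalshSeries, dif_pos h]
  exact h.choose_spec S

lemma rieszSeries_eq_prod {F : Set A} {z : A → ℂ} (hz : ∀ α, α ∉ F → z α = 0) (S : Finset A) :
    rieszSeries F z S = ∏ α ∈ S, z α := by
  rw [rieszSeries]
  split_ifs with h
  · rfl
  · obtain ⟨α, hα, hn⟩ := Set.not_subset.1 h
    exact (Finset.prod_eq_zero hα (hz α hn)).symm

/-- This keeps `ofWalshSeries` away from its default value 0. -/
lemma exists_linf_rieszSeries {F : Set A} {x : A → ℝ} (hx : InUnitBall x)
    (hF : ∀ α, α ∉ F → x α = 0) :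
    ∃ f : Linf A, ‖f‖ ≤ 2 ∧ ∀ S, walshCoeff f S = rieszSeries F (fun α => Complex.I * x α) S := by
  obtain ⟨f, hf, hfc⟩ := exists_linf_riesz hx
  exact ⟨f, hf, fun S => by rw [hfc, rieszSeries_eq_prod fun α hα => by simp [hF α hα]]⟩

lemma walshCoeff_riesz {F : Set A} {x : A → ℝ} (hx : InUnitBall x)
    (hF : ∀ α, α ∉ F → x α = 0) (S : Finset A) :
    walshCoeff (riesz F x) S = ∏ α ∈ S, Complex.I * x α := by
  obtain ⟨f, -, hf⟩ := exists_linf_rieszSeries hx hF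
  rw [riesz, walshCoeff_ofWalshSeries ⟨f, hf⟩, rieszSeries_eq_prod fun α hα => by simp [hF α hα]]

lemma norm_riesz_le {F : Set A} {x : A → ℝ} (hx : InUnitBall x)
    (hF : ∀ α, α ∉ F → x α = 0) : ‖riesz F x‖ ≤ 2 := by
  obtain ⟨f, hf2, hf⟩ := exists_linf_rieszSeries hx hF
  have : riesz F x = f := ext_walshCoeff fun S => by
    rw [riesz, walshCoeff_ofWalshSeries ⟨f, hf⟩, hf]
  rwa [this]

lemma coeFn_Q (F : Set A) (x : A → ℝ) :
    ∀ᵐ ω ∂prob A, Q F x ω = ((riesz F x ω).im : ℂ) :=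
  ContinuousLinearMap.coeFn_compLp (Complex.ofRealCLM.comp Complex.imCLM) (riesz F x)

lemma norm_Q_le {F : Set A} {x : A → ℝ} (hx : InUnitBall x)
    (hF : ∀ α, α ∉ F → x α = 0) : ‖Q F x‖ ≤ 2 := by
  refine linf_norm_le zero_le_two ?_
  filter_upwards [coeFn_Q F x, ae_norm_le (riesz F x)] with ω h1 h2
  rw [h1, Complex.norm_real]
  exact (Complex.abs_im_le_norm _).trans (h2.trans (norm_riesz_le hx hF))

lemma walshCoeff_Q {F : Set A} {x : A → ℝ} (hx : InUnitBall x)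
    (hF : ∀ α, α ∉ F → x α = 0) (S : Finset A) :
    walshCoeff (Q F x) S = ((∏ α ∈ S, Complex.I * x α).im : ℂ) := by
  rw [← walshCoeff_riesz hx hF, walshCoeff, walshCoeff]
  have h := (integrable_walsh_mul (riesz F x) S)
  have him : (∫ ω, walsh S ω * riesz F x ω ∂prob A).im =
      ∫ ω, (walsh S ω * riesz F x ω).im ∂prob A :=
    (integral_im h).symm
  rw [him, ← integral_complex_ofReal]
  refine integral_congr_ae ?_
  filter_upwards [coeFn_Q F x] with ω h1
  have hre : walsh S ω = ((walsh S ω).re : ℂ) := (Complex.conj_eq_iff_re.1 (conj_walsh S ω)).symm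
  rw [h1, hre, Complex.im_ofReal_mul]
  push_cast
  rfl

/-! ### Testing continuity against positive Riesz products -/

lemma exists_finset_walshCoeff_eq_zero {p : Linf A} (hp : p ∈ walshSpan A) :
    ∃ T : Finset A, ∀ S, ¬ S ⊆ T → walshCoeff p S = 0 := by
  classical
  unfold walshSpan at hp
  induction hp using Submodule.span_induction with
  | mem f hf =>
    obtain ⟨T, rfl⟩ := hf
    refine ⟨T, fun S hS => ?_⟩
    rw [walshCoeff_walshLinf, if_neg]
    rintro rfl
    exact hS subset_rfl
  | zero => exact ⟨∅, fun S _ => by rw [← walshCoeffCLM_apply, map_zero]⟩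
  | add f g _ _ hf hg =>
    obtain ⟨T, hT⟩ := hf
    obtain ⟨U, hU⟩ := hg
    refine ⟨T ∪ U, fun S hS => ?_⟩
    rw [← walshCoeffCLM_apply, map_add, walshCoeffCLM_apply, walshCoeffCLM_apply,
      hT S fun h => hS (h.trans Finset.subset_union_left),
      hU S fun h => hS (h.trans Finset.subset_union_right), add_zero]
  | smul c f _ hf =>
    obtain ⟨T, hT⟩ := hf
    refine ⟨T, fun S hS => ?_⟩
    rw [← walshCoeffCLM_apply, map_smul, walshCoeffCLM_apply, hT S hS, smul_zero]

/-- The sum is the integral of `f` against `∏ (1 + t α r_α)`, which is nonnegative with integral 1.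
-/
lemma norm_sum_prod_mul_walshCoeff_le (f : Linf A) {t : A → ℝ} (ht : ∀ α, |t α| ≤ 1)
    (F : Finset A) :
    ‖∑ S ∈ F.powerset, (∏ α ∈ S, (t α : ℂ)) * walshCoeff f S‖ ≤ ‖f‖ := by
  let h : Omega A → ℂ := fun ω => ∏ α ∈ F, (1 + (t α : ℂ) * (((ω α : ℤˣ) : ℤ) : ℂ))
  have hsum : ∀ ω, h ω = ∑ S ∈ F.powerset, (∏ α ∈ S, (t α : ℂ)) * walsh S ω :=
    prod_one_add_mul_eq_sum_walsh _ F
  have hwi : ∀ S : Finset A, Integrable (walsh S) (prob A) := fun S =>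
    (memLp_top_of_bound (measurable_walsh S).aestronglyMeasurable 1
      (ae_of_all _ fun ω => (norm_walsh S ω).le)).integrable le_top
  have hint : Integrable h (prob A) := by
    refine Integrable.congr (integrable_finsetSum F.powerset fun S _ =>
      (hwi S).const_mul (∏ α ∈ S, (t α : ℂ))) (ae_of_all _ fun ω => (hsum ω).symm)
  have hone : ∫ ω, h ω ∂prob A = 1 := by
    simp_rw [hsum]
    rw [integral_finsetSum _ fun S _ => (hwi S).const_mul _,
      Finset.sum_eq_single_of_mem ∅ (Finset.empty_mem_powerset F)]
    · simp [walsh_empty]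
    · intro S _ hS
      rw [integral_const_mul, integral_walsh_of_nonempty (Finset.nonempty_iff_ne_empty.2 hS),
        mul_zero]
  have hnorm : ∀ ω, ‖h ω‖ = (h ω).re := fun ω => by
    have hr : h ω = ((∏ α ∈ F, (1 + t α * ((ω α : ℤˣ) : ℤ)) : ℝ) : ℂ) := by
      simp only [h]; push_cast; rfl
    rw [hr, Complex.norm_real, Complex.ofReal_re, Real.norm_eq_abs, abs_of_nonneg]
    refine Finset.prod_nonneg fun α _ => ?_
    have := abs_le.1 (ht α)
    rcases Int.units_eq_one_or (ω α) with h | h <;> simp [h] <;> linarith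
  have heq : ∑ S ∈ F.powerset, (∏ α ∈ S, (t α : ℂ)) * walshCoeff f S =
      ∫ ω, h ω * f ω ∂prob A := by
    have : ∀ ω, h ω * f ω = ∑ S ∈ F.powerset, (∏ α ∈ S, (t α : ℂ)) * (walsh S ω * f ω) :=
      fun ω => by
        rw [hsum, Finset.sum_mul]
        exact Finset.sum_congr rfl fun S _ => mul_assoc _ _ _
    simp_rw [this]
    rw [integral_finsetSum _ fun S _ => (integrable_walsh_mul f S).const_mul _]
    exact Finset.sum_congr rfl fun S _ => (integral_const_mul _ _).symm
  rw [heq]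
  calc ‖∫ ω, h ω * f ω ∂prob A‖ ≤ ∫ ω, (h ω).re * ‖f‖ ∂prob A := by
        refine norm_integral_le_of_norm_le (hint.re.mul_const _) ?_
        filter_upwards [ae_norm_le f] with ω hω
        rw [norm_mul, hnorm]
        exact mul_le_mul_of_nonneg_left hω (hnorm ω ▸ norm_nonneg _)
    _ = (∫ ω, h ω ∂prob A).re * ‖f‖ := by
        rw [integral_mul_const]
        congr 1
        exact integral_re hint
    _ = ‖f‖ := by rw [hone, Complex.one_re, one_mul]

lemma norm_prod_one_add_sub_one_sub_sum_le {ι : Type*} (F : Finset ι) (f : ι → ℂ) :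
    ‖∏ i ∈ F, (1 + f i) - 1 - ∑ i ∈ F, f i‖ ≤
      Real.exp (∑ i ∈ F, ‖f i‖) - 1 - ∑ i ∈ F, ‖f i‖ := by
  classical
  induction F using Finset.induction_on with
  | empty => simp
  | insert a F ha ih =>
    have h1 := F.norm_prod_one_add_sub_one_le f
    rw [Finset.prod_insert ha, Finset.sum_insert ha, Finset.sum_insert ha, Real.exp_add]
    set P := ∏ i ∈ F, (1 + f i)
    set s := ∑ i ∈ F, ‖f i‖
    have h2 : (1 + f a) * P - 1 - (f a + ∑ i ∈ F, f i) =
        (P - 1 - ∑ i ∈ F, f i) + f a * (P - 1) := by ring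
    rw [h2]
    have h3 := norm_add_le (P - 1 - ∑ i ∈ F, f i) (f a * (P - 1))
    rw [norm_mul] at h3
    have h4 := mul_le_mul_of_nonneg_left h1 (norm_nonneg (f a))
    have h5 := mul_le_mul_of_nonneg_right (Real.add_one_le_exp ‖f a‖) (Real.exp_nonneg s)
    linarith

/-- The linear part contributes exactly 1, and the terms of order at least 2 contribute at most `e -
2 < 3/4`. -/
lemma one_fourth_le_im_prod_one_add_I_mul {F : Finset A} {y : A → ℝ} (hy : ∀ α, 0 ≤ y α)
    (hsum : ∑ α ∈ F, y α = 1) :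
    1 / 4 ≤ (∏ α ∈ F, (1 + Complex.I * (y α : ℂ))).im := by
  have h := norm_prod_one_add_sub_one_sub_sum_le F fun α => Complex.I * (y α : ℂ)
  have h1 : ∀ α, ‖Complex.I * (y α : ℂ)‖ = y α := fun α => by
    rw [norm_mul, Complex.norm_I, one_mul, Complex.norm_real, Real.norm_eq_abs,
      abs_of_nonneg (hy α)]
  have h2 : ∑ α ∈ F, Complex.I * (y α : ℂ) = Complex.I := by
    rw [← Finset.mul_sum, ← Complex.ofReal_sum, hsum, Complex.ofReal_one, mul_one]
  simp only [h1, h2, hsum] at h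
  have h3 := (Complex.abs_im_le_norm _).trans h
  simp only [Complex.sub_im, Complex.one_im, Complex.I_im, sub_zero] at h3
  have := (abs_le.1 h3).1
  linarith [Real.exp_one_lt_d9]

lemma exists_disjoint_one_le_sum {u : A → ℝ} (hu : ¬ Summable fun α => |u α|) (T : Finset A) :
    ∃ F : Finset A, Disjoint F T ∧ (∀ α ∈ F, u α ≠ 0) ∧ 1 ≤ ∑ α ∈ F, |u α| := by
  classical
  by_contra! hcon
  refine hu (summable_of_sum_le (c := ∑ α ∈ T, |u α| + 1) (fun _ => abs_nonneg _) fun F => ?_)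
  have h1 := hcon ((F \ T).filter fun α => u α ≠ 0)
    (Finset.disjoint_of_subset_left (Finset.filter_subset _ _) Finset.sdiff_disjoint)
    fun α hα => (Finset.mem_filter.1 hα).2
  have h2 : ∑ α ∈ (F \ T).filter (fun α => u α ≠ 0), |u α| = ∑ α ∈ F \ T, |u α| :=
    Finset.sum_filter_of_ne fun α _ h => abs_ne_zero.1 h
  have h3 : ∑ α ∈ F ∩ T, |u α| ≤ ∑ α ∈ T, |u α| :=
    Finset.sum_le_sum_of_subset_of_nonneg Finset.inter_subset_right fun _ _ _ => abs_nonneg _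
  have h4 : ∑ α ∈ F ∩ T, |u α| + ∑ α ∈ F \ T, |u α| = ∑ α ∈ F, |u α| :=
    Finset.sum_inter_add_sum_sdiff F T fun α => |u α|
  linarith

/-- If the real parts of the Walsh coefficients of a continuous function are, on the characters
over `B`, those of the imaginary part of the Riesz product of `u`, then `u` is summable. -/
lemma summable_abs_of_isContinuousClass {f : Linf A} (hf : IsContinuousClass f) {B : Set A}
    {u : A → ℝ} (hu : ∀ α, α ∉ B → u α = 0)
    (hfu : ∀ S : Finset A, (S : Set A) ⊆ B →
      (walshCoeff f S).re = (∏ α ∈ S, Complex.I * (u α : ℂ)).im) :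
    Summable fun α => |u α| := by
  classical
  by_contra hns
  -- The error is incurred twice, once for the Riesz test and once for the constant coefficient;
  -- `2/10 < 1/4` gives the contradiction.
  obtain ⟨p, hp, hd⟩ := Metric.mem_closure_iff.1 (isContinuousClass_iff.1 hf) (1 / 10)
    (by norm_num)
  rw [dist_eq_norm] at hd
  obtain ⟨T, hT⟩ := exists_finset_walshCoeff_eq_zero hp
  obtain ⟨F, hFT, hF0, hF1⟩ := exists_disjoint_one_le_sum hns T
  set σ := ∑ α ∈ F, |u α| with hσ
  have hσ0 : 0 < σ := one_pos.trans_le hF1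
  -- Chosen so that `t α * u α = |u α| / σ` sums to 1 over `F`; `σ ≥ 1` ensures `|t α| ≤ 1`.
  let t : A → ℝ := fun α => SignType.sign (u α) / σ
  have ht : ∀ α, |t α| ≤ 1 := fun α => by
    simp only [t]
    rw [abs_div, abs_of_pos hσ0]
    refine (div_le_one hσ0).2 (le_trans ?_ hF1)
    rcases lt_trichotomy (u α) 0 with h | h | h <;> simp [h]
  have htu : ∀ α, t α * u α = |u α| / σ := fun α => by
    rw [div_mul_eq_mul_div, sign_mul_self]
  have hFB : ∀ S ∈ F.powerset, (S : Set A) ⊆ B := fun S hS α hα => by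
    by_contra hn
    exact hF0 α (Finset.mem_powerset.1 hS hα) (hu α hn)
  have hlow := one_fourth_le_im_prod_one_add_I_mul (F := F) (y := fun α => |u α| / σ)
    (fun α => div_nonneg (abs_nonneg _) hσ0.le) (by rw [← Finset.sum_div, ← hσ, div_self hσ0.ne'])
  have hre : (∏ α ∈ F, (1 + Complex.I * ((|u α| / σ : ℝ) : ℂ))).im =
      (∑ S ∈ F.powerset, (∏ α ∈ S, (t α : ℂ)) * walshCoeff f S).re := by
    rw [Finset.prod_one_add, Complex.im_sum, Complex.re_sum]
    refine Finset.sum_congr rfl fun S hS => ?_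
    rw [← Complex.ofReal_prod, Complex.re_ofReal_mul, hfu S (hFB S hS), ← Complex.im_ofReal_mul,
      Complex.ofReal_prod, ← Finset.prod_mul_distrib]
    congr 1
    refine Finset.prod_congr rfl fun α _ => ?_
    rw [← htu]
    push_cast
    ring
  have hp0 : ∑ S ∈ F.powerset, (∏ α ∈ S, (t α : ℂ)) * walshCoeff p S = walshCoeff p ∅ := by
    rw [Finset.sum_eq_single_of_mem ∅ (Finset.empty_mem_powerset F)]
    · simp
    · intro S hS hne
      rw [hT S, mul_zero]
      intro hST
      obtain ⟨α, hα⟩ := Finset.nonempty_iff_ne_empty.2 hne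
      exact Finset.disjoint_left.1 hFT (Finset.mem_powerset.1 hS hα) (hST hα)
  have hsub : ∀ S, walshCoeff (f - p) S = walshCoeff f S - walshCoeff p S := fun S =>
    map_sub (walshCoeffCLM S) f p
  have h1 := norm_sum_prod_mul_walshCoeff_le (f - p) ht F
  simp only [hsub, mul_sub, Finset.sum_sub_distrib, hp0] at h1
  -- The empty product tests against 1: as the constant coefficient of `f` has real part 0, that of
  -- `p` has real part at most `1/10` in modulus.
  have h2 := norm_sum_prod_mul_walshCoeff_le (f - p) ht ∅
  simp only [hsub, Finset.powerset_empty, Finset.sum_singleton, Finset.prod_empty, one_mul] at h2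
  have h3 := (Complex.abs_re_le_norm _).trans (h1.trans hd.le)
  have h4 := (Complex.abs_re_le_norm _).trans (h2.trans hd.le)
  have h5 := hfu ∅ (by simp)
  rw [Finset.prod_empty, Complex.one_im] at h5
  rw [Complex.sub_re, ← hre] at h3
  rw [Complex.sub_re, h5] at h4
  have h6 := (abs_le.1 h3).2
  have h7 := (abs_le.1 h4).1
  linarith

/-! ### Coefficients of odd order -/

/-- Adjoining an index swaps parities, so both bounds are proved together, from the addition
formulas with `a ≤ sinh a` and `1 ≤ cosh a`. -/
lemma sum_odd_even_prod_le {a : A → ℝ} (ha : ∀ α, 0 ≤ a α) (T : Finset A) :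
    (∑ S ∈ T.powerset, if Odd S.card then ∏ α ∈ S, a α else 0) ≤ Real.sinh (∑ α ∈ T, a α) ∧
    (∑ S ∈ T.powerset, if Odd S.card then 0 else ∏ α ∈ S, a α) ≤ Real.cosh (∑ α ∈ T, a α) := by
  classical
  induction T using Finset.induction_on with
  | empty => simp
  | insert b T hb ih =>
    obtain ⟨ih1, ih2⟩ := ih
    have h1 : ∀ S ∈ T.powerset, (insert b S).card = S.card + 1 := fun S hS =>
      Finset.card_insert_of_notMem fun h => hb (Finset.mem_powerset.1 hS h)
    have h2 : ∀ S ∈ T.powerset, ∏ α ∈ insert b S, a α = a b * ∏ α ∈ S, a α := fun S hS =>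
      Finset.prod_insert fun h => hb (Finset.mem_powerset.1 hS h)
    rw [Finset.sum_powerset_insert hb, Finset.sum_powerset_insert hb, Finset.sum_insert hb,
      Real.sinh_add, Real.cosh_add]
    have h3 : (∑ S ∈ T.powerset, if Odd (insert b S).card then ∏ α ∈ insert b S, a α else 0) =
        a b * ∑ S ∈ T.powerset, if Odd S.card then 0 else ∏ α ∈ S, a α := by
      rw [Finset.mul_sum]
      refine Finset.sum_congr rfl fun S hS => ?_
      rw [h1 S hS, h2 S hS]
      simp only [Nat.odd_add_one, ite_not, mul_ite, mul_zero]
    have h4 : (∑ S ∈ T.powerset, if Odd (insert b S).card then 0 else ∏ α ∈ insert b S, a α) =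
        a b * ∑ S ∈ T.powerset, if Odd S.card then ∏ α ∈ S, a α else 0 := by
      rw [Finset.mul_sum]
      refine Finset.sum_congr rfl fun S hS => ?_
      rw [h1 S hS, h2 S hS]
      simp only [Nat.odd_add_one, ite_not, mul_ite, mul_zero]
    rw [h3, h4]
    have hs : 0 ≤ ∑ α ∈ T, a α := Finset.sum_nonneg fun α _ => ha α
    have hsh := Real.sinh_nonneg_iff.2 hs
    have hch := (Real.cosh_pos (∑ α ∈ T, a α)).le
    have hc1 := Real.one_le_cosh (a b)
    have hs1 := Real.self_le_sinh_iff.2 (ha b)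
    have e1 := mul_le_mul_of_nonneg_left ih1 (ha b)
    have e2 := mul_le_mul_of_nonneg_left ih2 (ha b)
    have e3 := mul_le_mul_of_nonneg_right hs1 hch
    have e4 := mul_le_mul_of_nonneg_right hs1 hsh
    have e5 := mul_le_mul_of_nonneg_right hc1 hch
    have e6 := mul_le_mul_of_nonneg_right hc1 hsh
    constructor <;> linarith

/-- With `T` the union of the sets in `C`, its singletons are odd sets outside `C`; adding them to
`C` accounts for the subtracted linear term. -/
lemma sum_prod_le_sinh_sub {a : A → ℝ} (ha : ∀ α, 0 ≤ a α) (C : Finset (Finset A))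
    (hC : ∀ S ∈ C, ∃ k : ℕ, 1 ≤ k ∧ S.card = 2 * k + 1) :
    ∃ T : Finset A, ∑ S ∈ C, ∏ α ∈ S, a α ≤ Real.sinh (∑ α ∈ T, a α) - ∑ α ∈ T, a α := by
  classical
  refine ⟨C.biUnion id, ?_⟩
  set T := C.biUnion id
  let N : Finset (Finset A) := T.map ⟨singleton, Finset.singleton_injective⟩
  have hdisj : Disjoint C N := by
    rw [Finset.disjoint_left]
    intro S hS hN
    obtain ⟨α, -, rfl⟩ := Finset.mem_map.1 hN
    obtain ⟨k, hk, hc⟩ := hC _ hS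
    simp only [Function.Embedding.coeFn_mk, Finset.card_singleton] at hc
    omega
  have hsub : C ∪ N ⊆ T.powerset := by
    intro S hS
    rw [Finset.mem_powerset]
    rcases Finset.mem_union.1 hS with h | h
    · exact Finset.subset_biUnion_of_mem id h
    · obtain ⟨α, hα, rfl⟩ := Finset.mem_map.1 h
      exact Finset.singleton_subset_iff.2 hα
  have hodd : ∀ S ∈ C ∪ N, Odd S.card := by
    intro S hS
    rcases Finset.mem_union.1 hS with h | h
    · obtain ⟨k, -, hk⟩ := hC S h
      exact ⟨k, hk⟩
    · obtain ⟨α, hα, rfl⟩ := Finset.mem_map.1 h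
      simp
  have hN : ∑ S ∈ N, ∏ α ∈ S, a α = ∑ α ∈ T, a α := by
    simp [N, Finset.sum_map]
  have h1 : ∑ S ∈ C ∪ N, ∏ α ∈ S, a α ≤ Real.sinh (∑ α ∈ T, a α) := by
    refine le_trans ?_ (sum_odd_even_prod_le ha T).1
    rw [Finset.sum_congr rfl fun S hS => (if_pos (hodd S hS)).symm]
    refine Finset.sum_le_sum_of_subset_of_nonneg hsub fun S _ _ => ?_
    split_ifs
    exacts [Finset.prod_nonneg fun α _ => ha α, le_rfl]
  rw [Finset.sum_union hdisj, hN] at h1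
  linarith

lemma abs_im_prod_I_mul_le (y : A → ℝ) (S : Finset A) :
    |(∏ α ∈ S, Complex.I * (y α : ℂ)).im| ≤ ∏ α ∈ S, |y α| := by
  refine (Complex.abs_im_le_norm _).trans_eq ?_
  rw [norm_prod]
  exact Finset.prod_congr rfl fun α _ => by simp

lemma delta_sq : delta ^ 2 = Real.sinh 1 - 1 :=
  Real.sq_sqrt (by linarith [Real.self_lt_sinh_iff.2 one_pos])

lemma delta_pos : 0 < delta :=
  Real.sqrt_pos.2 (by linarith [Real.self_lt_sinh_iff.2 one_pos])

lemma delta_lt_one : delta < 1 := by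
  have h : Real.sinh 1 < 2 := by
    rw [Real.sinh_eq]
    linarith [Real.exp_one_lt_d9, Real.exp_pos (-1)]
  have := delta_sq
  exact lt_of_pow_lt_pow_left₀ 2 zero_le_one (by linarith)

/-- Apply the previous bound to `y α ^ 2`; `sinh s - s` is increasing and equals `delta ^ 2` at `s =
1`. -/
lemma sum_sq_im_prod_le_delta_sq {y : A → ℝ} (hy : InUnitBall y) (C : Finset (Finset A))
    (hC : ∀ S ∈ C, ∃ k : ℕ, 1 ≤ k ∧ S.card = 2 * k + 1) :
    ∑ S ∈ C, (∏ α ∈ S, Complex.I * (y α : ℂ)).im ^ 2 ≤ delta ^ 2 := by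
  obtain ⟨T, hT⟩ := sum_prod_le_sinh_sub (fun α => sq_nonneg (y α)) C hC
  rw [delta_sq]
  refine le_trans (Finset.sum_le_sum fun S _ => ?_)
    (hT.trans (Real.sinh_sub_id_strictMono.monotone (hy T)))
  rw [← sq_abs]
  refine (pow_le_pow_left₀ (abs_nonneg _) (abs_im_prod_I_mul_le y S) 2).trans_eq ?_
  rw [← Finset.prod_pow]
  exact Finset.prod_congr rfl fun α _ => sq_abs _

/-! ### The vectors entering the construction -/

lemma sum_le_of_equiv {ι : Type*} {B : Set A} (e : ι ≃ B) {G : ι → ℝ} {g : A → ℝ} {c : ℝ}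
    (hG : ∀ C : Finset ι, ∑ i ∈ C, G i ≤ c) (hg : ∀ β (h : β ∈ B), g β = G (e.symm ⟨β, h⟩))
    (hg0 : ∀ β, β ∉ B → g β = 0) (T : Finset A) : ∑ β ∈ T, g β ≤ c := by
  classical
  have h1 : ∑ β ∈ T, g β = ∑ β ∈ T.subtype (· ∈ B), g β := by
    rw [Finset.sum_subtype_eq_sum_filter]
    exact (Finset.sum_filter_of_ne fun β _ h => by_contra fun hn => h (hg0 β hn)).symm
  have h2 := hG ((T.subtype (· ∈ B)).map e.symm.toEmbedding)
  rw [Finset.sum_map] at h2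
  rw [h1]
  exact (Finset.sum_congr rfl fun β _ => hg β.1 β.2).trans_le h2

/-- The vector `x^{(j+1)} / δ^j`. -/
noncomputable def scaledLevel (D : Scheme A) (x : A → ℝ) (j : ℕ) (α : A) : ℝ :=
  level D x j α / delta ^ j

lemma scaledLevel_zero_base (D : Scheme A) (x : A → ℝ) (β : A) (h : β ∈ D.block 0) :
    scaledLevel D x 0 β = x (D.base.symm ⟨β, h⟩) := by
  simp [scaledLevel, level, h]

lemma scaledLevel_of_notMem (D : Scheme A) (x : A → ℝ) (j : ℕ) (β : A) (h : β ∉ D.block j) :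
    scaledLevel D x j β = 0 := by
  cases j <;> simp [scaledLevel, level, h]

lemma scaledLevel_succ (D : Scheme A) (x : A → ℝ) (j : ℕ) (β : A) (h : β ∈ D.block (j + 1)) :
    scaledLevel D x (j + 1) β =
      (walshCoeff (Q (D.block j) (scaledLevel D x j))
        ((D.step j).symm ⟨β, h⟩ : Finset A)).re / delta := by
  have hδ := delta_pos.ne'
  change level D x (j + 1) β / delta ^ (j + 1) =
    (walshCoeff (Q (D.block j) fun α => level D x j α / delta ^ j) _).re / delta
  simp only [level, dif_pos h]
  field_simp
  ring

lemma inUnitBall_scaledLevel (D : Scheme A) {x : A → ℝ} (hx : InUnitBall x) (j : ℕ) :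
    InUnitBall (scaledLevel D x j) := by
  induction j with
  | zero =>
    refine sum_le_of_equiv D.base (G := fun α => x α ^ 2) hx (fun β h => ?_) fun β h => ?_
    · rw [scaledLevel_zero_base D x β h]
    · rw [scaledLevel_of_notMem D x 0 β h, zero_pow two_ne_zero]
  | succ j ih =>
    refine sum_le_of_equiv (D.step j)
      (G := fun S => ((∏ α ∈ S.1, Complex.I * (scaledLevel D x j α : ℂ)).im / delta) ^ 2)
      (fun C => ?_) (fun β h => ?_) fun β h => ?_
    · have h := sum_sq_im_prod_le_delta_sq ih (C.map (Function.Embedding.subtype _))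
        fun S hS => by
          obtain ⟨S, -, rfl⟩ := Finset.mem_map.1 hS
          exact S.2.2
      rw [Finset.sum_map] at h
      simp_rw [div_pow]
      rw [← Finset.sum_div]
      exact (div_le_one (pow_pos delta_pos 2)).2 h
    · rw [scaledLevel_succ D x j β h,
        walshCoeff_Q ih (scaledLevel_of_notMem D x j), Complex.ofReal_re]
    · rw [scaledLevel_of_notMem D x _ β h, zero_pow two_ne_zero]

/-- The next level is a relabelling of Walsh coefficients, up to the factor `1 / delta`, and these
are dominated by products of absolute values, summable over finite sets. -/
lemma summable_scaledLevel (D : Scheme A) {x : A → ℝ} (hx : InUnitBall x)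
    (hs : Summable fun α => |x α|) (j : ℕ) : Summable fun α => |scaledLevel D x j α| := by
  induction j with
  | zero =>
    refine summable_of_sum_le (c := ∑' α, |x α|) (fun _ => abs_nonneg _)
      (sum_le_of_equiv D.base (G := fun α => |x α|)
        (fun C => hs.sum_le_tsum C fun _ _ => abs_nonneg _) (fun β h => ?_) fun β h => ?_)
    · rw [scaledLevel_zero_base D x β h]
    · rw [scaledLevel_of_notMem D x 0 β h, abs_zero]
  | succ j ih =>
    have hP := (summable_finsetProd_of_summable_nonneg (fun α => abs_nonneg _) ih).of_nonneg_of_le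
      (fun S => abs_nonneg _) (abs_im_prod_I_mul_le (scaledLevel D x j))
    have hG := (hP.div_const delta).comp_injective
      (Subtype.val_injective (p := (· ∈ oddChars (D.block j))))
    refine summable_of_sum_le (fun _ => abs_nonneg _)
      (sum_le_of_equiv (D.step j)
        (fun C => hG.sum_le_tsum C fun _ _ => div_nonneg (abs_nonneg _) delta_pos.le)
        (fun β h => ?_) fun β h => ?_)
    · rw [scaledLevel_succ D x j β h,
        walshCoeff_Q (inUnitBall_scaledLevel D hx j) (scaledLevel_of_notMem D x j),
        Complex.ofReal_re, abs_div, abs_of_pos delta_pos]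
    · rw [scaledLevel_of_notMem D x _ β h, abs_zero]

lemma summable_of_summable_scaledLevel_zero (D : Scheme A) {x : A → ℝ}
    (hs : Summable fun α => |scaledLevel D x 0 α|) : Summable fun α => |x α| := by
  refine (hs.comp_injective (Subtype.val_injective.comp D.base.injective)).congr fun α => ?_
  simp [scaledLevel_zero_base D x _ (D.base α).2]

lemma isContinuousClass_Q {F : Set A} {x : A → ℝ} (hx : InUnitBall x)
    (hF : ∀ α, α ∉ F → x α = 0) (hs : Summable fun α => |x α|) :
    IsContinuousClass (Q F x) := by
  refine isContinuousClass_of_summable ?_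
  refine (summable_finsetProd_of_summable_nonneg (fun α => abs_nonneg _) hs).of_nonneg_of_le
    (fun S => norm_nonneg _) fun S => ?_
  rw [walshCoeff_Q hx hF, Complex.norm_real]
  exact abs_im_prod_I_mul_le x S

/-! ### The map `Φ` on real vectors -/

lemma hasSum_PhiReal (D : Scheme A) {x : A → ℝ} (hx : InUnitBall x) :
    HasSum (fun j : ℕ => (Complex.I * (delta : ℂ)) ^ j • Q (D.block j) (scaledLevel D x j))
      (PhiReal D x) := by
  refine Summable.hasSum (Summable.of_norm_bounded
    ((summable_geometric_of_lt_one delta_pos.le delta_lt_one).mul_right 2) fun j => ?_)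
  rw [norm_smul, norm_pow, norm_mul, Complex.norm_I, one_mul, Complex.norm_real,
    Real.norm_of_nonneg delta_pos.le]
  exact mul_le_mul_of_nonneg_left
    (norm_Q_le (inUnitBall_scaledLevel D hx j) (scaledLevel_of_notMem D x j))
    (pow_nonneg delta_pos.le j)

/-- For nonempty `S` disjointness of the blocks kills the terms with `j ≠ 0`; for `S = ∅` every term
vanishes, as `Im 1 = 0`. -/
lemma walshCoeff_PhiReal (D : Scheme A) {x : A → ℝ} (hx : InUnitBall x) {S : Finset A}
    (hS : (S : Set A) ⊆ D.block 0) :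
    walshCoeff (PhiReal D x) S =
      ((∏ α ∈ S, Complex.I * (scaledLevel D x 0 α : ℂ)).im : ℂ) := by
  have h := (hasSum_PhiReal D hx).mapL (walshCoeffCLM S)
  simp only [map_smul, walshCoeffCLM_apply, smul_eq_mul,
    fun j => walshCoeff_Q (inUnitBall_scaledLevel D hx j) (scaledLevel_of_notMem D x j)] at h
  refine h.unique ?_
  have h0 := hasSum_single (f := fun j : ℕ => (Complex.I * (delta : ℂ)) ^ j *
    ((∏ α ∈ S, Complex.I * (scaledLevel D x j α : ℂ)).im : ℂ)) 0 fun j hj => by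
      rcases S.eq_empty_or_nonempty with rfl | ⟨α, hα⟩
      · simp
      · have hn : α ∉ D.block j := fun hm =>
          Set.disjoint_left.1 (D.disjoint_block hj) hm (hS hα)
        rw [Finset.prod_eq_zero hα (by rw [scaledLevel_of_notMem D x j α hn]; simp)]
        simp
  simpa using h0

lemma isContinuousClass_PhiReal (D : Scheme A) {x : A → ℝ} (hx : InUnitBall x)
    (hs : Summable fun α => |x α|) : IsContinuousClass (PhiReal D x) := by
  rw [isContinuousClass_iff]
  refine (Submodule.isClosed_topologicalClosure _).mem_of_tendsto (hasSum_PhiReal D hx)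
    (Filter.Eventually.of_forall fun s => Submodule.sum_mem _ fun j _ =>
      Submodule.smul_mem _ _ (isContinuousClass_iff.1 ?_))
  exact isContinuousClass_Q (inUnitBall_scaledLevel D hx j) (scaledLevel_of_notMem D x j)
    (summable_scaledLevel D hx hs j)

/-! ### The map `Φ` on complex vectors -/

lemma memlp_one_iff {E : Type*} [NormedAddCommGroup E] {x : A → E} :
    Memℓp x 1 ↔ Summable fun α => ‖x α‖ := by
  rw [memℓp_gen_iff (by simp)]
  simp

lemma sum_sq_norm_le_one {E : Type*} [NormedAddCommGroup E]
    (x : Metric.closedBall (0 : lp (fun _ : A => E) 2) 1) (T : Finset A) :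
    ∑ α ∈ T, ‖x.1 α‖ ^ 2 ≤ 1 := by
  have h := lp.sum_rpow_le_norm_rpow (p := 2) (by simp) x.1 T
  have hx : ‖x.1‖ ≤ 1 := mem_closedBall_zero_iff.1 x.2
  simp only [ENNReal.toReal_ofNat, Real.rpow_ofNat] at h
  exact h.trans (pow_le_one₀ (norm_nonneg _) hx)

lemma inUnitBall_real (x : Metric.closedBall (0 : lp (fun _ : A => ℝ) 2) 1) :
    InUnitBall (x.1 : A → ℝ) := fun T => by
  simpa using sum_sq_norm_le_one x T

lemma inUnitBall_re (x : Metric.closedBall (0 : lp (fun _ : A => ℂ) 2) 1) :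
    InUnitBall fun α => (x.1 α).re := fun T =>
  (Finset.sum_le_sum fun _ _ => sq_le_sq' (abs_le.1 (Complex.abs_re_le_norm _)).1
    (abs_le.1 (Complex.abs_re_le_norm _)).2).trans (sum_sq_norm_le_one x T)

lemma inUnitBall_im (x : Metric.closedBall (0 : lp (fun _ : A => ℂ) 2) 1) :
    InUnitBall fun α => (x.1 α).im := fun T =>
  (Finset.sum_le_sum fun _ _ => sq_le_sq' (abs_le.1 (Complex.abs_im_le_norm _)).1
    (abs_le.1 (Complex.abs_im_le_norm _)).2).trans (sum_sq_norm_le_one x T)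

lemma isContinuousClass_Q_univ_iff (x : Metric.closedBall (0 : lp (fun _ : A => ℝ) 2) 1) :
    IsContinuousClass (Q Set.univ (x.1 : A → ℝ)) ↔ Memℓp (x.1 : A → ℝ) 1 := by
  have hx := inUnitBall_real x
  have hu : ∀ α, α ∉ (Set.univ : Set A) → x.1 α = 0 := fun α h => absurd (Set.mem_univ α) h
  rw [memlp_one_iff]
  refine ⟨fun h => summable_abs_of_isContinuousClass h hu fun S _ => ?_,
    isContinuousClass_Q hx hu⟩
  rw [walshCoeff_Q hx hu, Complex.ofReal_re]

lemma isContinuousClass_Phi_iff (D : Scheme A)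
    (x : Metric.closedBall (0 : lp (fun _ : A => ℂ) 2) 1) :
    IsContinuousClass (Phi D x) ↔ Memℓp (x.1 : A → ℂ) 1 := by
  have hu := inUnitBall_re x
  have hv := inUnitBall_im x
  rw [memlp_one_iff]
  constructor
  · intro h
    have hcoef : ∀ S : Finset A, walshCoeff (Phi D x) S =
        walshCoeff (PhiReal D fun α => (x.1 α).re) S +
          Complex.I * walshCoeff (PhiReal D fun α => (x.1 α).im) S := fun S => by
      simp only [Phi, ← walshCoeffCLM_apply, map_add, map_smul, smul_eq_mul]
    -- Over the first block both real maps have real coefficients, so real parts isolate `u`;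
    -- multiplying by `-i` isolates `v`.
    have h' : IsContinuousClass (-Complex.I • Phi D x) :=
      isContinuousClass_iff.2 (Submodule.smul_mem _ _ (isContinuousClass_iff.1 h))
    have h1 := summable_of_summable_scaledLevel_zero D
      (summable_abs_of_isContinuousClass h (scaledLevel_of_notMem D (fun α => (x.1 α).re) 0)
        fun S hS => by
          rw [hcoef, walshCoeff_PhiReal D hu hS, walshCoeff_PhiReal D hv hS]
          simp)
    have h2 := summable_of_summable_scaledLevel_zero D
      (summable_abs_of_isContinuousClass h' (scaledLevel_of_notMem D (fun α => (x.1 α).im) 0)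
        fun S hS => by
          rw [← walshCoeffCLM_apply, map_smul, walshCoeffCLM_apply, hcoef,
            walshCoeff_PhiReal D hu hS, walshCoeff_PhiReal D hv hS]
          simp)
    exact (h1.add h2).of_nonneg_of_le (fun _ => norm_nonneg _)
      fun α => Complex.norm_le_abs_re_add_abs_im _
  · intro h
    have h1 := isContinuousClass_iff.1 (isContinuousClass_PhiReal D hu
      (h.of_nonneg_of_le (fun _ => abs_nonneg _) fun α => Complex.abs_re_le_norm _))
    have h2 := isContinuousClass_iff.1 (isContinuousClass_PhiReal D hv
      (h.of_nonneg_of_le (fun _ => abs_nonneg _) fun α => Complex.abs_im_le_norm _))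
    exact isContinuousClass_iff.2 (Submodule.add_mem _ h1 (Submodule.smul_mem _ _ h2))

/-! ### Discontinuity of `Φ` -/

lemma exists_mem_closedBall_not_memlp_one [Infinite A] :
    ∃ x : Metric.closedBall (0 : lp (fun _ : A => ℂ) 2) 1, ¬ Memℓp (x.1 : A → ℂ) 1 := by
  let e : ℕ ↪ A := Infinite.natEmbedding A
  -- A harmonic sequence on a countable subset is square summable but not summable.
  let f : A → ℂ := Function.extend e (fun n : ℕ => ((n : ℂ) + 1)⁻¹) 0
  have hfe : ∀ n, f (e n) = ((n : ℂ) + 1)⁻¹ := fun n => e.injective.extend_apply _ _ n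
  have hf0 : ∀ α, α ∉ range e → f α = 0 := fun α h => Function.extend_apply' _ _ _ h
  have hnorm : ∀ n : ℕ, ‖((n : ℂ) + 1)⁻¹‖ = (((n + 1 : ℕ) : ℝ))⁻¹ := fun n => by
    rw [norm_inv, ← Nat.cast_add_one, Complex.norm_natCast]
  have hf : Memℓp f 2 := by
    rw [memℓp_gen_iff (by simp), ← e.injective.summable_iff fun α h => by simp [hf0 α h]]
    refine ((summable_nat_add_iff 1).2
      (Real.summable_nat_pow_inv.2 (one_lt_two : 1 < 2))).congr fun n => ?_
    simp only [Function.comp_apply, hfe, hnorm, ENNReal.toReal_ofNat, Real.rpow_ofNat, inv_pow]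
  let g : lp (fun _ : A => ℂ) 2 := ⟨f, hf⟩
  have hc : 0 < ‖g‖ + 1 := by positivity
  refine ⟨⟨((‖g‖ + 1 : ℝ) : ℂ)⁻¹ • g, mem_closedBall_zero_iff.2 ?_⟩, fun h => ?_⟩
  · rw [norm_smul, norm_inv, Complex.norm_real, Real.norm_of_nonneg hc.le, inv_mul_le_one₀ hc]
    linarith
  · rw [memlp_one_iff] at h
    have h1 := (h.comp_injective e.injective).mul_left (‖g‖ + 1)
    refine Real.not_summable_natCast_inv ((summable_nat_add_iff 1).1 (h1.congr fun n => ?_))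
    have h2 : (((‖g‖ + 1 : ℝ) : ℂ)⁻¹ • g : lp (fun _ : A => ℂ) 2) (e n) =
        ((‖g‖ + 1 : ℝ) : ℂ)⁻¹ * ((n : ℂ) + 1)⁻¹ := by
      rw [lp.coeFn_smul, Pi.smul_apply, smul_eq_mul]
      exact congrArg _ (hfe n)
    simp only [Function.comp_apply]
    rw [h2, norm_mul, hnorm, norm_inv, Complex.norm_real, Real.norm_of_nonneg hc.le,
      mul_inv_cancel_left₀ hc.ne']

lemma not_continuous_Phi [Infinite A] (D : Scheme A) : ¬ Continuous (Phi D) := by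
  classical
  intro hcont
  obtain ⟨x, hx⟩ := exists_mem_closedBall_not_memlp_one (A := A)
  have hball : ∀ s : Finset A,
      (∑ α ∈ s, lp.single 2 α (x.1 α) : lp (fun _ : A => ℂ) 2) ∈ Metric.closedBall 0 1 :=
    fun s => by
      have h := lp.norm_sum_single (p := 2) (by simp) (fun α => x.1 α) s
      simp only [ENNReal.toReal_ofNat, Real.rpow_ofNat] at h
      refine mem_closedBall_zero_iff.2 (le_of_sq_le_sq ?_ zero_le_one)
      rw [h, one_pow]
      exact sum_sq_norm_le_one x s
  -- Finite truncations stay in the ball and converge in `l²`, though `x` is not in `l¹`.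
  have hlim : Filter.Tendsto (fun s : Finset A =>
      (⟨_, hball s⟩ : Metric.closedBall (0 : lp (fun _ : A => ℂ) 2) 1)) Filter.atTop (nhds x) :=
    tendsto_subtype_rng.2 (lp.hasSum_single (by simp) x.1)
  refine hx ((isContinuousClass_Phi_iff D x).1 (isContinuousClass_iff.2 ?_))
  refine (Submodule.isClosed_topologicalClosure _).mem_of_tendsto
    ((hcont.tendsto x).comp hlim) (Filter.Eventually.of_forall fun s => ?_)
  refine isContinuousClass_iff.1 ((isContinuousClass_Phi_iff D _).2 (memlp_one_iff.2 ?_))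
  refine summable_of_ne_finset_zero (s := s) fun β hβ => ?_
  rw [norm_eq_zero, lp.coeFn_sum, Finset.sum_apply]
  refine Finset.sum_eq_zero fun α hα => ?_
  rw [lp.single_apply_ne]
  rintro rfl
  exact hβ hα

end WalshSeries

theorem corollary3 {A : Type*} :
    (∀ x : Metric.closedBall (0 : lp (fun _ : A => ℝ) 2) 1,
      Dyadic.IsContinuousClass (Dyadic.Q Set.univ (x.1 : A → ℝ)) ↔ Memℓp (x.1 : A → ℝ) 1) ∧
    (Infinite A → ∀ D : Dyadic.Scheme A,
      (∀ x : Metric.closedBall (0 : lp (fun _ : A => ℂ) 2) 1,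
        Dyadic.IsContinuousClass (Dyadic.Phi D x) ↔ Memℓp (x.1 : A → ℂ) 1) ∧
      ¬ Continuous (Dyadic.Phi D)) :=
  ⟨WalshSeries.isContinuousClass_Q_univ_iff, fun _ D =>
    ⟨WalshSeries.isContinuousClass_Phi_iff D, WalshSeries.not_continuous_Phi D⟩⟩
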